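/- Conventions. For a finite tree $T$ of order $n=|V(T)|$ and diameter $d=\operatorname{diam}(T)$, a radio labeling is a map $f:V(T)\to\{0,1,2,\dots\}$ with $d_T(u,v)+|f(u)-f(v)|\ge \operatorname{diam}(T)+1$ for all distinct $u,v\in V(T)$, and the radio number $\operatorname{rn}(T)$ is the minimum of $\max_{v} f(v)$ over all radio labelings $f$ of $T$. A weight center of $T$ is a vertex $v$ minimizing $\sum_{u\in V(T)} d_T(u,v)$; $W(T)$ is the set of weight centers (it has one element or two adjacent ones). Put $\varepsilon(T)=1$ if $|W(T)|=1$ and $\varepsilon(T)=0$ if $|W(T)|=2$, let $L(T)=\sum_{u\in V(T)}\min_{x\in W(T)} d_T(u,x)$, and let $$\operatorname{lb}(T)=(n-1)(d+\varepsilon(T))-2L(T)+\varepsilon(T).$$ $T$ is called a lower bound tree if $\operatorname{rn}(T)=\operatorname{lb}(T)$. Theorem. Let $k\ge 1$ and let $T_1,\dots,T_k$ be lower bound trees, where $T_i$ has order $n_i$, diameter $d_i$ and a unique weight center $w_i$. Let $T_{w_k}$ be the tree obtained from the disjoint union of $T_1,\dots,T_k$ by identifying the vertices $w_1,\dots,w_k$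 to a single vertex $w$, and let $d=\operatorname{diam}(T_{w_k})$. Then $T_{w_k}$ is a lower bound tree, and $$\operatorname{rn}(T_{w_k})=\sum_{i=1}^{k}\bigl(\operatorname{rn}(T_i)+(n_i-1)(d-d_i)\bigr)-k+1.$$ -/

import Mathlib

namespace RadioTree

section Graph

variable {V : Type*}

/-- A radio labeling: `d(u,v) + |f(u) - f(v)| ≥ diam(G) + 1` for all distinct vertices `u`, `v`. -/
def IsRadioLabeling (G : SimpleGraph V) (f : V → ℕ) : Prop :=
  ∀ u v : V, u ≠ v → (G.diam : ℤ) + 1 ≤ (G.dist u v : ℤ) + |(f u : ℤ) - (f v : ℤ)|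

/-- The span of a labeling: its largest label. -/
def span [Fintype V] (f : V → ℕ) : ℕ :=
  Finset.univ.sup f

/-- The radio number: the least span of a radio labeling.
(A finite graph always has a radio labeling, so the minimum is attained.) -/
noncomputable def radioNumber [Fintype V] (G : SimpleGraph V) : ℕ :=
  sInf {m : ℕ | ∃ f : V → ℕ, IsRadioLabeling G f ∧ span f = m}

/-- The weight of `G` from `v`: the sum of the distances from all vertices to `v`. -/
noncomputable def weightFrom [Fintype V] (G : SimpleGraph V) (v : V) : ℕ :=
  ∑ u : V, G.dist u v

/-- The set `W(G)` of weight centers: the vertices from which the weight is minimum. -/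
def weightCenters [Fintype V] (G : SimpleGraph V) : Set V :=
  {v | ∀ u : V, weightFrom G v ≤ weightFrom G u}

/-- The level of `u`: the least distance from `u` to a weight center. -/
noncomputable def level [Fintype V] (G : SimpleGraph V) (u : V) : ℕ :=
  sInf {m : ℕ | ∃ x ∈ weightCenters G, G.dist u x = m}

/-- The total level `L(G)`. -/
noncomputable def totalLevel [Fintype V] (G : SimpleGraph V) : ℕ :=
  ∑ u : V, level G u

open Classical in
/-- `ε(G)`: `1` if there is only one weight center, `0` otherwise
(for a tree, "otherwise" means two adjacent weight centers). -/
noncomputable def eps [Fintype V] (G : SimpleGraph V) : ℤ :=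
  if (weightCenters G).ncard = 1 then 1 else 0

/-- `lb(G) = (n - 1)(d + ε) - 2 L(G) + ε`, with `n` the order and `d` the diameter. -/
noncomputable def lb [Fintype V] (G : SimpleGraph V) : ℤ :=
  ((Fintype.card V : ℤ) - 1) * ((G.diam : ℤ) + eps G) - 2 * (totalLevel G : ℤ) + eps G

/-- A lower bound tree: a tree whose radio number equals `lb`. -/
def IsLowerBoundTree [Fintype V] (G : SimpleGraph V) : Prop :=
  G.IsTree ∧ (radioNumber G : ℤ) = lb G

end Graph

section Glue

variable {ι : Type*} {V : ι → Type*}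

/-- The vertex set of the disjoint union of the `V i` after all the `w i` have been identified
to a single vertex: `none` is that vertex, `some ⟨i, x⟩` is the vertex `x ≠ w i` of `V i`. -/
abbrev GluedVertex (w : ∀ i, V i) : Type _ :=
  Option (Σ i, {x : V i // x ≠ w i})

/-- The canonical map from `V i` to the glued vertex set, sending `w i` to the common vertex. -/
def toGlued [∀ i, DecidableEq (V i)] (w : ∀ i, V i) (i : ι) (x : V i) : GluedVertex w :=
  if h : x = w i then none else some ⟨i, x, h⟩

/-- Two vertices are identified exactly when they are equal or are both among the `w i`. -/
theorem toGlued_eq_iff [∀ i, DecidableEq (V i)] (w : ∀ i, V i) {i j : ι} (x : V i) (y : V j) :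
    toGlued w i x = toGlued w j y ↔
      (⟨i, x⟩ : Σ i, V i) = ⟨j, y⟩ ∨ (x = w i ∧ y = w j) := by
  by_cases hx : x = w i
  · by_cases hy : y = w j
    · simp [toGlued, hx, hy]
    · have : ¬ ((⟨i, w i⟩ : Σ i, V i) = ⟨j, y⟩) := by
        rintro h
        cases h
        exact hy rfl
      subst hx
      simp [toGlued, hy, this]
  · by_cases hy : y = w j
    · have : ¬ ((⟨i, x⟩ : Σ i, V i) = ⟨j, w j⟩) := by
        rintro h
        cases h
        exact hx rfl
      subst hy
      simp [toGlued, hx, this]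
    · simp only [toGlued, hx, hy, dif_neg, not_false_iff, Option.some.injEq, false_and, or_false]
      constructor
      · rintro h
        cases h
        rfl
      · rintro h
        cases h
        rfl

/-- The graph obtained from the disjoint union of the `T i` by identifying all the `w i`:
its edges are the images of the edges of the `T i`. -/
def glue [∀ i, DecidableEq (V i)] (T : ∀ i, SimpleGraph (V i)) (w : ∀ i, V i) :
    SimpleGraph (GluedVertex w) where
  Adj a b := ∃ (i : ι) (x y : V i), (T i).Adj x y ∧ toGlued w i x = a ∧ toGlued w i y = b
  symm := by
    constructor
    rintro a b ⟨i, x, y, h, hx, hy⟩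
    exact ⟨i, y, x, h.symm, hy, hx⟩
  loopless := by
    constructor
    rintro a ⟨i, x, y, h, hx, hy⟩
    rcases (toGlued_eq_iff w x y).1 (hx.trans hy.symm) with e | ⟨e₁, e₂⟩
    · cases e
      exact (T i).loopless.irrefl _ h
    · subst e₁
      subst e₂
      exact (T i).loopless.irrefl _ h

end Glue

end RadioTree

/-!
For a connected graph with a unique weight center `w`, list the vertices `u_0, ..., u_{n-1}` in
increasing order of their labels. The radio condition and the triangle inequality through `w` bound
each gap between consecutive labels below by `diam + 1 - d(u_t, w) - d(u_{t+1}, w)`. Summing gives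
`lb` as a lower bound for the span (`lb_le_radioNumber`), and shows that in a labeling attaining it
the first and the last vertex are `w` and a neighbor of `w`; complementing the labels if necessary,
`w` comes first (`exists_isRadioLabeling_first_eq`).

The glued graph is a tree whose only weight center is the common vertex, distances inside a part
are unchanged, and distances between different parts are sums of distances to the common vertex
(`isTree_glue`, `weightCenters_glue`, `dist_toGlued_self`, `dist_toGlued_of_ne`). So the lower bound
applies to it, and `lb` of the glued graph is the claimed value of the radio number.

For the upper bound, let `d` be the diameter of the glued graph. The optimal labelings of the parts
are stretched by `d - d_i` at each of the `n_i - 1` gaps (`exists_stretched_labeling`), and then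
concatenated (`radioNumber_glue_le`): since each ends at a neighbor of `w` and the next one starts
at `w` itself, the next one may start one label below the largest label used so far. This
saves one label for each part after the first.
-/

namespace RadioTree

/-! ### Optimal labelings of graphs with a unique weight center -/

section Graph

variable {V : Type*} {G : SimpleGraph V}

theorem le_add_dist_of_adj (hG : G.Connected) {F : V → ℕ}
    (hF : ∀ a b, G.Adj a b → F b ≤ F a + 1) (a b : V) : F b ≤ F a + G.dist a b := by
  obtain ⟨p, hp⟩ := hG.exists_walk_length_eq_dist a b
  rw [← hp]
  clear hp
  induction p with
  | nil => simp
  | cons h p ih =>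
    have := hF _ _ h
    rw [SimpleGraph.Walk.length_cons]
    omega

theorem dist_le_diam_of_connected [Finite V] (hG : G.Connected) (u v : V) :
    G.dist u v ≤ G.diam := by
  have := hG.nonempty
  exact SimpleGraph.dist_le_diam (SimpleGraph.connected_iff_ediam_ne_top.1 hG)

theorem one_le_diam [Finite V] [Nontrivial V] (hG : G.Connected) : 1 ≤ G.diam :=
  Nat.one_le_iff_ne_zero.2 (SimpleGraph.connected_iff_diam_ne_zero.1 hG)

theorem IsRadioLabeling.injective [Finite V] (hG : G.Connected) {f : V → ℕ}
    (hf : IsRadioLabeling G f) : Function.Injective f := by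
  intro u v huv
  by_contra hne
  have h := hf u v hne
  have := dist_le_diam_of_connected hG u v
  simp only [huv, sub_self, abs_zero] at h
  omega

theorem one_le_dist_first_add_dist_last (hG : G.Connected) {m : ℕ} (e : Fin (m + 1 + 1) ≃ V)
    (w : V) : 1 ≤ G.dist (e 0) w + G.dist (e (Fin.last _)) w := by
  by_contra hlt
  have h0 : e 0 = w := hG.dist_eq_zero_iff.1 (by omega)
  have h1 : e (Fin.last _) = w := hG.dist_eq_zero_iff.1 (by omega)
  have := e.injective (h0.trans h1.symm)
  simp [Fin.ext_iff] at this

variable [Fintype V]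

theorem lb_eq_of_weightCenters_eq_singleton {w : V} (hw : weightCenters G = {w}) :
    lb G = ((Fintype.card V : ℤ) - 1) * ((G.diam : ℤ) + 1)
      - 2 * ∑ u, (G.dist u w : ℤ) + 1 := by
  have hlevel : ∀ u, level G u = G.dist u w := by
    intro u
    have : {m : ℕ | ∃ x ∈ weightCenters G, G.dist u x = m} = {G.dist u w} := by
      ext m
      simp [hw, eq_comm]
    rw [level, this, csInf_singleton]
  have heps : eps G = 1 := by simp [eps, hw]
  simp [lb, totalLevel, hlevel, heps]

theorem exists_isRadioLabeling (G : SimpleGraph V) : ∃ f : V → ℕ, IsRadioLabeling G f := by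
  refine ⟨fun v => (G.diam + 1) * (Fintype.equivFin V v : ℕ), fun u v huv => ?_⟩
  have hne : ((Fintype.equivFin V u : ℕ) : ℤ) - (Fintype.equivFin V v : ℕ) ≠ 0 := by
    rw [sub_ne_zero]
    exact_mod_cast fun h => huv ((Fintype.equivFin V).injective (Fin.ext h))
  have h1 := Int.one_le_abs hne
  push_cast
  rw [← mul_sub, abs_mul, abs_of_nonneg (by positivity : (0 : ℤ) ≤ (G.diam : ℤ) + 1)]
  nlinarith [Int.natCast_nonneg (G.dist u v), Int.natCast_nonneg G.diam]

theorem exists_isRadioLabeling_span_eq (G : SimpleGraph V) :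
    ∃ f : V → ℕ, IsRadioLabeling G f ∧ span f = radioNumber G := by
  obtain ⟨f, hf⟩ := exists_isRadioLabeling G
  exact Nat.sInf_mem (s := {m : ℕ | ∃ f : V → ℕ, IsRadioLabeling G f ∧ span f = m}) ⟨_, f, hf, rfl⟩

theorem radioNumber_le_of_forall_le {f : V → ℕ} (hf : IsRadioLabeling G f) {m : ℕ}
    (hm : ∀ v, f v ≤ m) : radioNumber G ≤ m :=
  (Nat.sInf_le (s := {m : ℕ | ∃ f : V → ℕ, IsRadioLabeling G f ∧ span f = m})
    ⟨f, hf, rfl⟩).trans (Finset.sup_le fun v _ => hm v)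

theorem le_span (f : V → ℕ) (v : V) : f v ≤ span f :=
  Finset.le_sup (f := f) (Finset.mem_univ v)

/-- The vertices can be listed in increasing order of their labels. -/
theorem exists_equiv_strictMono {f : V → ℕ} (hf : Function.Injective f) {m : ℕ}
    (hm : Fintype.card V = m + 1) : ∃ e : Fin (m + 1) ≃ V, StrictMono (f ∘ e) := by
  let e₀ : Fin (m + 1) ≃ V := (Fintype.equivFinOfCardEq hm).symm
  refine ⟨(Tuple.sort (f ∘ e₀)).trans e₀, ?_⟩
  exact (Tuple.monotone_sort (f ∘ e₀)).strictMono_of_injective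
    (hf.comp ((Tuple.sort (f ∘ e₀)).trans e₀).injective)

/-- Consecutive labels differ by at least `diam + 1 - d(u, w) - d(v, w)`, by the radio condition
and the triangle inequality through `w`; summing along the order of the labels counts every
distance to `w` twice, except those of the first and the last vertex. -/
theorem IsRadioLabeling.le_last_sub_first (hG : G.Connected) {f : V → ℕ}
    (hf : IsRadioLabeling G f) {m : ℕ} (e : Fin (m + 1) ≃ V) (he : StrictMono (f ∘ e)) (w : V) :
    (m : ℤ) * ((G.diam : ℤ) + 1) - 2 * ∑ u, (G.dist u w : ℤ)
      + G.dist (e 0) w + G.dist (e (Fin.last m)) w ≤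
    (f (e (Fin.last m)) : ℤ) - f (e 0) := by
  have hstep : ∀ t : Fin m, (G.diam : ℤ) + 1 - G.dist (e t.castSucc) w - G.dist (e t.succ) w ≤
      (f (e t.succ) : ℤ) - f (e t.castSucc) := by
    intro t
    have hlt : f (e t.castSucc) < f (e t.succ) := he (Fin.castSucc_lt_succ)
    have h := hf (e t.succ) (e t.castSucc)
      (fun h => by rw [h] at hlt; exact lt_irrefl _ hlt)
    rw [abs_of_nonneg (by omega)] at h
    have htri := hG.dist_triangle (u := e t.succ) (v := w) (w := e t.castSucc)
    rw [G.dist_comm (u := w)] at htri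
    omega
  have hsum := Finset.sum_le_sum fun t (_ : t ∈ (Finset.univ : Finset (Fin m))) => hstep t
  simp only [Finset.sum_sub_distrib, Finset.sum_const, Finset.card_univ, Fintype.card_fin,
    nsmul_eq_mul] at hsum
  have hL₁ := Fin.sum_univ_succ fun t => (G.dist (e t) w : ℤ)
  have hL₂ := Fin.sum_univ_castSucc fun t => (G.dist (e t) w : ℤ)
  have hf₁ := Fin.sum_univ_succ fun t => (f (e t) : ℤ)
  have hf₂ := Fin.sum_univ_castSucc fun t => (f (e t) : ℤ)
  rw [e.sum_comp fun u => (G.dist u w : ℤ)] at hL₁ hL₂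
  linarith

theorem lb_le_radioNumber [Nontrivial V] (hG : G.Connected) {w : V}
    (hw : weightCenters G = {w}) : lb G ≤ radioNumber G := by
  obtain ⟨f, hf, hspan⟩ := exists_isRadioLabeling_span_eq G
  obtain ⟨m, hm⟩ := Nat.exists_eq_add_of_lt (Fintype.one_lt_card (α := V))
  obtain ⟨e, he⟩ := exists_equiv_strictMono (hf.injective hG) (m := m + 1) (by omega)
  have h := hf.le_last_sub_first hG e he w
  have hlast := le_span f (e (Fin.last _))
  have hpos := one_le_dist_first_add_dist_last hG e w
  rw [lb_eq_of_weightCenters_eq_singleton hw, hm]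
  push_cast at h ⊢
  rw [← hspan]
  have : (1 : ℤ) + m + 1 - 1 = m + 1 := by ring
  rw [this]
  omega

/-- An optimal labeling attaining `lb` can be taken to start at the weight center `w`. Equality
in the lower bound makes the first and the last vertex `w` and a neighbor of `w`, in one order or
the other, and complementing the labels exchanges the two orders. -/
theorem exists_isRadioLabeling_first_eq [Nontrivial V] (hG : G.Connected) {w : V}
    (hw : weightCenters G = {w}) (hlb : (radioNumber G : ℤ) = lb G) :
    ∃ (m : ℕ) (f : V → ℕ) (e : Fin (m + 1) ≃ V), Fintype.card V = m + 1 ∧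
      IsRadioLabeling G f ∧ StrictMono (f ∘ e) ∧ e 0 = w ∧ f w = 0 ∧
      G.dist (e (Fin.last m)) w = 1 ∧ f (e (Fin.last m)) = radioNumber G := by
  obtain ⟨f, hf, hspan⟩ := exists_isRadioLabeling_span_eq G
  obtain ⟨m, hm⟩ := Nat.exists_eq_add_of_lt (Fintype.one_lt_card (α := V))
  replace hm : Fintype.card V = (m + 1) + 1 := by omega
  obtain ⟨e, he⟩ := exists_equiv_strictMono (hf.injective hG) hm
  have h := hf.le_last_sub_first hG e he w
  have hlast := le_span f (e (Fin.last _))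
  rw [lb_eq_of_weightCenters_eq_singleton hw, hm] at hlb
  push_cast at h hlb
  have h2 : (m : ℤ) + 1 + 1 - 1 = m + 1 := by ring
  rw [h2] at hlb
  have hpos := one_le_dist_first_add_dist_last hG e w
  have hfirst : f (e 0) = 0 := by omega
  have hend : f (e (Fin.last _)) = radioNumber G := by omega
  have hsum : G.dist (e 0) w + G.dist (e (Fin.last _)) w = 1 := by omega
  rcases Nat.eq_zero_or_pos (G.dist (e 0) w) with h0 | h0
  · have hw0 : e 0 = w := hG.dist_eq_zero_iff.1 h0
    exact ⟨m + 1, f, e, hm, hf, he, hw0, hw0 ▸ hfirst, by omega, hend⟩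
  · have hw1 : e (Fin.last _) = w := hG.dist_eq_zero_iff.1 (by omega)
    have hle : ∀ v, f v ≤ radioNumber G := fun v => hspan ▸ le_span f v
    refine ⟨m + 1, fun v => radioNumber G - f v, Fin.revPerm.trans e, hm, ?_, ?_, ?_, ?_, ?_, ?_⟩
    · intro u v huv
      have h := hf u v huv
      rw [Nat.cast_sub (hle u), Nat.cast_sub (hle v), sub_sub_sub_cancel_left, abs_sub_comm]
      exact h
    · intro s t hst
      have := he (Fin.rev_lt_rev.2 hst)
      have h1 := hle (e s.rev)
      simp only [Function.comp_apply, Equiv.trans_apply, Fin.revPerm_apply] at this ⊢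
      omega
    · simpa using hw1
    · simp [← hw1, hend]
    · simp only [Equiv.trans_apply, Fin.revPerm_apply, Fin.rev_last]
      omega
    · simp [hfirst]

/-- An optimal labeling can be stretched to satisfy the radio condition for any `D ≥ diam G`:
adding `D - diam G` to each of the `n - 1` gaps between consecutive labels is enough. -/
theorem exists_stretched_labeling [Nontrivial V] (hG : G.Connected) {w : V}
    (hw : weightCenters G = {w}) (hlb : (radioNumber G : ℤ) = lb G) {D : ℕ} (hD : G.diam ≤ D) :
    ∃ (g : V → ℕ) (z : V),
      (∀ u v, u ≠ v → (D : ℤ) + 1 ≤ G.dist u v + |(g u : ℤ) - g v|) ∧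
      g w = 0 ∧ G.dist z w = 1 ∧
      (∀ v, g v ≤ g z) ∧ 1 ≤ g z ∧
      (g z : ℤ) = radioNumber G + ((Fintype.card V : ℤ) - 1) * ((D : ℤ) - G.diam) := by
  obtain ⟨m, f, e, hm, hf, he, h0, hfw, hz, hfz⟩ := exists_isRadioLabeling_first_eq hG hw hlb
  obtain ⟨c, rfl⟩ := Nat.exists_eq_add_of_le hD
  have hmono : ∀ u v, e.symm u ≤ e.symm v → f u ≤ f v := by
    intro u v h
    simpa using he.monotone h
  have hlast : e.symm (e (Fin.last m)) = Fin.last m := e.symm_apply_apply _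
  have hbound : ∀ v, f v + (e.symm v : ℕ) * c ≤
      f (e (Fin.last m)) + (e.symm (e (Fin.last m)) : ℕ) * c := by
    intro v
    have h1 := hmono v (e (Fin.last m)) (by rw [hlast]; exact Fin.le_last _)
    have h2 : (e.symm v : ℕ) ≤ (e.symm (e (Fin.last m)) : ℕ) := by
      rw [hlast]; exact Fin.le_last (e.symm v)
    gcongr
  refine ⟨fun v => f v + (e.symm v : ℕ) * c, e (Fin.last m), ?_, ?_, hz, hbound, ?_, ?_⟩
  · have key : ∀ u v, e.symm u < e.symm v →
        ((G.diam + c : ℕ) : ℤ) + 1 ≤ G.dist u v +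
          (((f v + (e.symm v : ℕ) * c : ℕ) : ℤ) - ((f u + (e.symm u : ℕ) * c : ℕ) : ℤ)) := by
      intro u v huv
      have h := hf u v (fun h => by rw [h] at huv; exact lt_irrefl _ huv)
      have hle := hmono u v huv.le
      rw [abs_sub_comm, abs_of_nonneg (by omega)] at h
      have hmul : ((e.symm u : ℕ) + 1) * c ≤ (e.symm v : ℕ) * c :=
        Nat.mul_le_mul_right _ (Nat.succ_le_of_lt huv)
      rw [add_mul, one_mul] at hmul
      omega
    intro u v huv
    rcases lt_or_gt_of_ne (e.symm.injective.ne huv) with hlt | hlt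
    · have := key u v hlt
      rw [abs_sub_comm]
      exact this.trans (by gcongr; exact le_abs_self _)
    · have := key v u hlt
      rw [G.dist_comm] at this
      exact this.trans (by gcongr; exact le_abs_self _)
  · simp [← h0, h0 ▸ hfw]
  · by_contra hlt
    have h1 : f (e (Fin.last m)) = f w := by
      rw [hfw]
      exact (Nat.add_eq_zero_iff.1 (Nat.lt_one_iff.1 (not_le.1 hlt))).1
    rw [hf.injective hG h1] at hz
    simp at hz
  · simp [hfz, hm]

/-- A single vertex has radio number `0` but `lb = 1`. -/
theorem nontrivial_of_radioNumber_eq_lb {w : V}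
    (hw : weightCenters G = {w}) (hlb : (radioNumber G : ℤ) = lb G) : Nontrivial V := by
  by_contra hV
  rw [not_nontrivial_iff_subsingleton] at hV
  have hle : radioNumber G ≤ 0 :=
    radioNumber_le_of_forall_le (f := fun _ => 0) (fun u v h => (h (Subsingleton.elim u v)).elim)
      fun _ => le_rfl
  have hcard : Fintype.card V = 1 := Fintype.card_eq_one_iff.2 ⟨w, fun y => Subsingleton.elim y w⟩
  have hdist : ∀ u, G.dist u w = 0 := fun u => by rw [Subsingleton.elim u w]; simp
  rw [lb_eq_of_weightCenters_eq_singleton hw, hcard] at hlb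
  simp only [hdist] at hlb
  simp at hlb
  omega

end Graph

/-! ### Distances and weights in the glued graph -/

section Glue

variable {ι : Type*} {V : ι → Type*} [∀ i, DecidableEq (V i)]

@[simp]
theorem toGlued_self (w : ∀ i, V i) (i : ι) : toGlued w i (w i) = none := by
  simp [toGlued]

theorem toGlued_of_ne (w : ∀ i, V i) {i : ι} {x : V i} (h : x ≠ w i) :
    toGlued w i x = some ⟨i, x, h⟩ := by
  simp [toGlued, h]

theorem exists_toGlued_eq [Nonempty ι] (w : ∀ i, V i) (v : GluedVertex w) :
    ∃ i x, toGlued w i x = v := by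
  rcases v with _ | ⟨i, x, hx⟩
  · exact ⟨Classical.arbitrary ι, _, toGlued_self w _⟩
  · exact ⟨i, x, toGlued_of_ne w hx⟩

/-- The canonical map from one of the graphs to the glued graph, as a graph homomorphism. -/
def toGluedHom (T : ∀ i, SimpleGraph (V i)) (w : ∀ i, V i) (i : ι) : T i →g glue T w where
  toFun := toGlued w i
  map_rel' {x y} h := ⟨i, x, y, h, rfl, rfl⟩

/-- The retraction of the glued vertex set onto `V i` that collapses all the other parts
to `w i`. -/
def retract [DecidableEq ι] (w : ∀ i, V i) (i : ι) : GluedVertex w → V i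
  | none => w i
  | some ⟨j, x⟩ => if h : j = i then h ▸ x.1 else w i

theorem retract_toGlued_self [DecidableEq ι] (w : ∀ i, V i) (i : ι) (x : V i) :
    retract w i (toGlued w i x) = x := by
  by_cases h : x = w i
  · simp [h, retract]
  · simp [toGlued_of_ne w h, retract]

theorem retract_toGlued_of_ne [DecidableEq ι] (w : ∀ i, V i) {i j : ι} (hij : j ≠ i) (x : V j) :
    retract w i (toGlued w j x) = w i := by
  by_cases h : x = w j
  · simp [h, retract]
  · simp [toGlued_of_ne w h, retract, hij]

theorem card_gluedVertex [Fintype ι] [∀ i, Fintype (V i)] (w : ∀ i, V i) :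
    (Fintype.card (GluedVertex w) : ℤ) = ∑ i, ((Fintype.card (V i) : ℤ) - 1) + 1 := by
  have h : ∀ i, (Fintype.card {x : V i // x ≠ w i} : ℤ) = (Fintype.card (V i) : ℤ) - 1 := by
    intro i
    have : 0 < Fintype.card (V i) := Fintype.card_pos_iff.2 ⟨w i⟩
    rw [show Fintype.card {x : V i // x ≠ w i} = Fintype.card (V i) - 1 by
      simp [Fintype.card_subtype_compl]]
    omega
  rw [Fintype.card_option, Fintype.card_sigma, Nat.cast_add, Nat.cast_sum, Nat.cast_one]
  simp only [h]

theorem sum_gluedVertex [Fintype ι] [∀ i, Fintype (V i)] (w : ∀ i, V i) (F : GluedVertex w → ℕ) :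
    ∑ v, F v = F none + ∑ i, ∑ x : {x : V i // x ≠ w i}, F (toGlued w i x) := by
  rw [Fintype.sum_option, Fintype.sum_sigma]
  congr 1
  refine Finset.sum_congr rfl fun i _ => Finset.sum_congr rfl fun x _ => ?_
  rw [toGlued_of_ne w x.2]

theorem add_sum_subtype_ne {α : Type*} [Fintype α] [DecidableEq α] (a : α) (F : α → ℕ) :
    F a + ∑ x : {x : α // x ≠ a}, F x = ∑ x, F x := by
  rw [← Finset.add_sum_erase _ _ (Finset.mem_univ a)]
  congr 1
  exact (Finset.sum_subtype _ (by simp) F).symm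

variable {T : ∀ i, SimpleGraph (V i)} {w : ∀ i, V i}

theorem connected_glue [Nonempty ι] (hT : ∀ i, (T i).Connected) : (glue T w).Connected := by
  rw [SimpleGraph.connected_iff_exists_forall_reachable]
  refine ⟨none, fun v => ?_⟩
  obtain ⟨i, x, rfl⟩ := exists_toGlued_eq w v
  rw [← toGlued_self w i]
  exact ((hT i) (w i) x).map (toGluedHom T w i)

theorem dist_toGlued_le (hT : ∀ i, (T i).Connected) (i : ι) (x y : V i) :
    (glue T w).dist (toGlued w i x) (toGlued w i y) ≤ (T i).dist x y := by
  obtain ⟨p, hp⟩ := (hT i).exists_walk_length_eq_dist x y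
  rw [← hp, ← SimpleGraph.Walk.length_map (toGluedHom T w i) p]
  exact SimpleGraph.dist_le _

/-- The glued graph is connected, and has at most as many edges as the parts have together. -/
theorem isTree_glue [Fintype ι] [∀ i, Fintype (V i)] [Nonempty ι]
    (hT : ∀ i, (T i).IsTree) : (glue T w).IsTree := by
  have hconn := connected_glue (w := w) fun i => (hT i).connected
  -- the reverse inequality holds in every connected graph
  refine SimpleGraph.isTree_iff_connected_and_card.2 ⟨hconn, le_antisymm ?_
    hconn.card_vert_le_card_edgeSet_add_one⟩
  have hsurj : Function.Surjective
      fun e : Σ i, (T i).edgeSet => (toGluedHom T w e.1).mapEdgeSet e.2 := by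
    rintro ⟨e, he⟩
    induction e with
    | _ a b =>
      obtain ⟨i, x, y, hxy, hx, hy⟩ := he
      refine ⟨⟨i, s(x, y), hxy⟩, Subtype.ext ?_⟩
      change s(toGlued w i x, toGlued w i y) = s(a, b)
      rw [hx, hy]
  have hcard : ∀ i, (Nat.card (T i).edgeSet : ℤ) = (Fintype.card (V i) : ℤ) - 1 := by
    intro i
    have := (SimpleGraph.isTree_iff_connected_and_card.1 (hT i)).2
    rw [Nat.card_eq_fintype_card (α := V i)] at this
    omega
  have hle : (Nat.card (glue T w).edgeSet : ℤ) ≤ ∑ i, ((Fintype.card (V i) : ℤ) - 1) := by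
    have := Nat.card_le_card_of_surjective _ hsurj
    rw [Nat.card_sigma] at this
    simp only [← hcard]
    exact_mod_cast this
  have := card_gluedVertex w
  rw [Nat.card_eq_fintype_card (α := GluedVertex w)]
  omega

variable [Fintype ι] [DecidableEq ι]

/-- The distance in the glued graph from the vertex `x` of `V i`, written with the retractions. -/
noncomputable def distFrom (T : ∀ i, SimpleGraph (V i)) (w : ∀ i, V i) (i : ι) (x : V i)
    (v : GluedVertex w) : ℕ :=
  (T i).dist x (retract w i v) + ∑ l ∈ Finset.univ.erase i, (T l).dist (w l) (retract w l v)

theorem distFrom_toGlued_self (i : ι) (x y : V i) :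
    distFrom T w i x (toGlued w i y) = (T i).dist x y := by
  rw [distFrom, retract_toGlued_self, Finset.sum_eq_zero, add_zero]
  intro l hl
  rw [retract_toGlued_of_ne w (Finset.ne_of_mem_erase hl).symm, SimpleGraph.dist_self]

theorem distFrom_toGlued_of_ne {i j : ι} (hij : i ≠ j) (x : V i) (y : V j) :
    distFrom T w i x (toGlued w j y) = (T i).dist x (w i) + (T j).dist (w j) y := by
  rw [distFrom, retract_toGlued_of_ne w hij.symm,
    Finset.sum_eq_single_of_mem j (Finset.mem_erase.2 ⟨hij.symm, Finset.mem_univ _⟩),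
    retract_toGlued_self]
  intro l _ hl
  rw [retract_toGlued_of_ne w hl.symm, SimpleGraph.dist_self]

/-- An edge of the glued graph lies in a single part, so `distFrom` changes by at most one
along it. -/
theorem distFrom_le_dist (hT : ∀ i, (T i).Connected) (i : ι) (x : V i) (v : GluedVertex w) :
    distFrom T w i x v ≤ (glue T w).dist (toGlued w i x) v := by
  have : Nonempty ι := ⟨i⟩
  have h := le_add_dist_of_adj (connected_glue (w := w) hT) (F := distFrom T w i x)
    (fun a b hab => ?_) (toGlued w i x) v
  · simpa [distFrom_toGlued_self] using h
  · obtain ⟨l, y, z, hyz, rfl, rfl⟩ := hab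
    have h1 : (T l).dist y z = 1 := SimpleGraph.dist_eq_one_iff_adj.2 hyz
    rcases eq_or_ne i l with rfl | hil
    · have := (hT i).dist_triangle (u := x) (v := y) (w := z)
      rw [distFrom_toGlued_self, distFrom_toGlued_self]
      omega
    · have := (hT l).dist_triangle (u := w l) (v := y) (w := z)
      rw [distFrom_toGlued_of_ne hil, distFrom_toGlued_of_ne hil]
      omega

theorem dist_toGlued_self (hT : ∀ i, (T i).Connected) (i : ι) (x y : V i) :
    (glue T w).dist (toGlued w i x) (toGlued w i y) = (T i).dist x y :=
  (dist_toGlued_le hT i x y).antisymm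
    (distFrom_toGlued_self (w := w) i x y ▸ distFrom_le_dist hT i x _)

theorem dist_toGlued_of_ne (hT : ∀ i, (T i).Connected) {i j : ι} (hij : i ≠ j) (x : V i)
    (y : V j) : (glue T w).dist (toGlued w i x) (toGlued w j y) =
      (T i).dist x (w i) + (T j).dist y (w j) := by
  have : Nonempty ι := ⟨i⟩
  rw [(T j).dist_comm]
  refine le_antisymm ?_ (distFrom_toGlued_of_ne (T := T) hij x y ▸ distFrom_le_dist hT i x _)
  have h1 := dist_toGlued_le (w := w) hT i x (w i)
  have h2 := dist_toGlued_le (w := w) hT j (w j) y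
  have h3 := (connected_glue (w := w) hT).dist_triangle (u := toGlued w i x) (v := none)
    (w := toGlued w j y)
  rw [toGlued_self] at h1 h2
  omega

theorem dist_toGlued_none (hT : ∀ i, (T i).Connected) (i : ι) (x : V i) :
    (glue T w).dist (toGlued w i x) none = (T i).dist x (w i) := by
  rw [← toGlued_self w i, dist_toGlued_self hT]

variable [∀ i, Fintype (V i)]

theorem diam_le_diam_glue (hT : ∀ i, (T i).Connected) (i : ι) :
    (T i).diam ≤ (glue T w).diam := by
  have : Nonempty ι := ⟨i⟩
  have := (hT i).nonempty
  obtain ⟨x, y, hxy⟩ := (T i).exists_dist_eq_diam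
  rw [← hxy, ← dist_toGlued_self (w := w) hT]
  exact dist_le_diam_of_connected (connected_glue hT) _ _

theorem weightFrom_glue_none (hT : ∀ i, (T i).Connected) :
    weightFrom (glue T w) none = ∑ i, weightFrom (T i) (w i) := by
  rw [weightFrom, sum_gluedVertex, SimpleGraph.dist_self, zero_add]
  refine Finset.sum_congr rfl fun i _ => ?_
  rw [weightFrom, ← add_sum_subtype_ne (w i), SimpleGraph.dist_self, zero_add]
  simp only [dist_toGlued_none hT]

/-- Moving away from the common vertex into the part `i` changes the weight by at least as much
as it does inside `V i`, since it increases the distances to all the other parts. -/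
theorem weightFrom_glue_none_add_le (hT : ∀ i, (T i).Connected) (i : ι) (x : V i) :
    weightFrom (glue T w) none + weightFrom (T i) x ≤
      weightFrom (glue T w) (toGlued w i x) + weightFrom (T i) (w i) := by
  rw [weightFrom_glue_none hT, weightFrom.eq_1 (glue T w), sum_gluedVertex,
    ← Finset.add_sum_erase _ _ (Finset.mem_univ i),
    ← Finset.add_sum_erase _ _ (Finset.mem_univ i)]
  have hi : (glue T w).dist none (toGlued w i x) +
      ∑ y : {y : V i // y ≠ w i}, (glue T w).dist (toGlued w i y) (toGlued w i x) =
      weightFrom (T i) x := by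
    rw [weightFrom, ← add_sum_subtype_ne (w i), ← toGlued_self w i]
    simp only [dist_toGlued_self hT]
  have hother : ∑ j ∈ Finset.univ.erase i, weightFrom (T j) (w j) ≤
      ∑ j ∈ Finset.univ.erase i,
        ∑ y : {y : V j // y ≠ w j}, (glue T w).dist (toGlued w j y) (toGlued w i x) := by
    refine Finset.sum_le_sum fun j hj => ?_
    rw [weightFrom, ← add_sum_subtype_ne (w j), SimpleGraph.dist_self, zero_add]
    refine Finset.sum_le_sum fun y _ => ?_
    rw [dist_toGlued_of_ne hT (Finset.ne_of_mem_erase hj)]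
    exact Nat.le_add_right _ _
  omega

theorem weightCenters_glue [Nonempty ι] (hT : ∀ i, (T i).Connected)
    (hw : ∀ i, weightCenters (T i) = {w i}) : weightCenters (glue T w) = {none} := by
  have hle : ∀ i x, weightFrom (T i) (w i) ≤ weightFrom (T i) x := fun i => by
    have : w i ∈ weightCenters (T i) := by simp [hw i]
    exact this
  refine Set.eq_singleton_iff_unique_mem.2 ⟨fun v => ?_, fun v hv => ?_⟩
  · obtain ⟨i, x, rfl⟩ := exists_toGlued_eq w v
    have := weightFrom_glue_none_add_le (w := w) hT i x
    have := hle i x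
    omega
  · obtain ⟨i, x, rfl⟩ := exists_toGlued_eq w v
    have h1 := weightFrom_glue_none_add_le (w := w) hT i x
    have h2 := hv none
    have hx : x ∈ weightCenters (T i) := fun u => (by omega : _ ≤ _).trans (hle i u)
    rw [hw i, Set.mem_singleton_iff] at hx
    rw [hx, toGlued_self]

end Glue

/-! ### Concatenating the labelings of the parts -/

section Labeling

variable {k : ℕ} {V : Fin k → Type*} [∀ i, Fintype (V i)] [∀ i, DecidableEq (V i)]
  {T : ∀ i, SimpleGraph (V i)} {w : ∀ i, V i}

/-- Labelings `g i` of the parts that start at `w i` and end at a neighbor `z i` of `w i` are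
put one after the other: each part starts one label below the largest label of the part
before it. -/
theorem radioNumber_glue_le (hT : ∀ i, (T i).Connected) {g : ∀ i, V i → ℕ} {z : ∀ i, V i}
    (hD : 1 ≤ (glue T w).diam)
    (hg : ∀ i u v, u ≠ v →
      ((glue T w).diam : ℤ) + 1 ≤ (T i).dist u v + |(g i u : ℤ) - g i v|)
    (hgw : ∀ i, g i (w i) = 0) (hz : ∀ i, (T i).dist (z i) (w i) = 1)
    (hgz : ∀ i v, g i v ≤ g i (z i)) (hpos : ∀ i, 1 ≤ g i (z i)) :
    radioNumber (glue T w) ≤ ∑ i, (g i (z i) - 1) + 1 := by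
  -- the shift of each part is the sum of the largest labels before it, less one for each of them
  let s : Fin k → ℕ := fun i => ∑ l ∈ Finset.Iio i, (g l (z l) - 1)
  have hs : ∀ i j, i < j → s i + (g i (z i) - 1) ≤ s j := by
    intro i j hij
    rw [add_comm, ← Finset.sum_insert (f := fun l => g l (z l) - 1) (a := i)
      (s := Finset.Iio i) (by simp)]
    refine Finset.sum_le_sum_of_subset fun l hl => ?_
    simp only [Finset.mem_insert, Finset.mem_Iio] at hl ⊢
    rcases hl with rfl | hl
    · exact hij
    · exact hl.trans hij
  have hs_total : ∀ i, s i + (g i (z i) - 1) ≤ ∑ i, (g i (z i) - 1) := by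
    intro i
    rw [add_comm, ← Finset.sum_insert (f := fun l => g l (z l) - 1) (a := i)
      (s := Finset.Iio i) (by simp)]
    exact Finset.sum_le_sum_of_subset (Finset.subset_univ _)
  -- the radio condition against `w i` and against `z i`
  have hlow : ∀ i x, x ≠ w i → ((glue T w).diam : ℤ) + 1 ≤ (T i).dist x (w i) + g i x := by
    intro i x hx
    have := hg i x (w i) hx
    simpa [hgw] using this
  have hhigh : ∀ i x, x ≠ z i →
      ((glue T w).diam : ℤ) ≤ (T i).dist x (w i) + (g i (z i) - g i x) := by
    intro i x hx
    have h := hg i x (z i) hx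
    have hle := hgz i x
    have htri := (hT i).dist_triangle (u := x) (v := w i) (w := z i)
    rw [(T i).dist_comm (u := w i), hz] at htri
    rw [abs_sub_comm, abs_of_nonneg (by omega)] at h
    omega
  let f : GluedVertex w → ℕ := fun v => v.elim 0 fun p => g p.1 p.2 + s p.1
  have key : ∀ i j, i < j → ∀ x y, x ≠ w i → y ≠ w j → ((glue T w).diam : ℤ) + 1 ≤
      ((T i).dist x (w i) + (T j).dist y (w j) : ℕ) +
        (((g j y + s j : ℕ) : ℤ) - (g i x + s i : ℕ)) := by
    intro i j hij x y hx hy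
    have h1 := hs i j hij
    have h2 := hlow j y hy
    have h3 := hpos i
    -- for `x = z i` the condition is tight; otherwise the two bounds add up to
    -- `2 * diam - d(x, w) - d(y, w)`, which suffices as `1 ≤ diam`
    rcases eq_or_ne x (z i) with rfl | hxz
    · have := hz i
      omega
    · have := hhigh i x hxz
      omega
  refine radioNumber_le_of_forall_le (f := f) ?_ ?_
  · rintro (_ | ⟨i, x, hx⟩) (_ | ⟨j, y, hy⟩) huv
    · exact (huv rfl).elim
    · have h := hlow j y hy
      rw [SimpleGraph.dist_comm, ← toGlued_of_ne w hy, dist_toGlued_none hT,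
        toGlued_of_ne w hy, abs_sub_comm]
      refine le_trans ?_ (add_le_add_right (le_abs_self _) _)
      simp only [f, Option.elim]
      omega
    · have h := hlow i x hx
      rw [← toGlued_of_ne w hx, dist_toGlued_none hT, toGlued_of_ne w hx]
      refine le_trans ?_ (add_le_add_right (le_abs_self _) _)
      simp only [f, Option.elim]
      omega
    · rcases lt_trichotomy i j with hij | rfl | hij
      · rw [← toGlued_of_ne w hx, ← toGlued_of_ne w hy, dist_toGlued_of_ne hT hij.ne,
          toGlued_of_ne w hx, toGlued_of_ne w hy, abs_sub_comm]
        exact (key i j hij x y hx hy).trans (add_le_add_right (le_abs_self _) _)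
      · have hxy : x ≠ y := fun h => huv (by subst h; rfl)
        rw [← toGlued_of_ne w hx, ← toGlued_of_ne w hy, dist_toGlued_self hT,
          toGlued_of_ne w hx, toGlued_of_ne w hy]
        simpa [f] using hg i x y hxy
      · rw [SimpleGraph.dist_comm, ← toGlued_of_ne w hx, ← toGlued_of_ne w hy,
          dist_toGlued_of_ne hT hij.ne, toGlued_of_ne w hx, toGlued_of_ne w hy]
        exact (key j i hij y x hy hx).trans (add_le_add_right (le_abs_self _) _)
  · rintro (_ | ⟨i, x, hx⟩)
    · exact Nat.zero_le _
    · have := hs_total i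
      have := hgz i x
      have := hpos i
      simp only [f, Option.elim]
      omega

end Labeling

end RadioTree

theorem theorem3p1 {k : ℕ} (hk : 1 ≤ k) {V : Fin k → Type*}
    [∀ i, Fintype (V i)] [∀ i, DecidableEq (V i)]
    (T : ∀ i, SimpleGraph (V i)) (w : ∀ i, V i)
    (hT : ∀ i, RadioTree.IsLowerBoundTree (T i))
    (hw : ∀ i, RadioTree.weightCenters (T i) = {w i}) :
    RadioTree.IsLowerBoundTree (RadioTree.glue T w) ∧
      (RadioTree.radioNumber (RadioTree.glue T w) : ℤ) =
        (∑ i, ((RadioTree.radioNumber (T i) : ℤ) +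
          ((Fintype.card (V i) : ℤ) - 1) *
            (((RadioTree.glue T w).diam : ℤ) - ((T i).diam : ℤ)))) - (k : ℤ) + 1 := by
  have : Nonempty (Fin k) := ⟨⟨0, hk⟩⟩
  have hconn : ∀ i, (T i).Connected := fun i => (hT i).1.connected
  have hnt : ∀ i, Nontrivial (V i) := fun i =>
    RadioTree.nontrivial_of_radioNumber_eq_lb (hw i) (hT i).2
  have hglue := RadioTree.connected_glue (w := w) hconn
  have hcenter := RadioTree.weightCenters_glue hconn hw
  have hdiam := RadioTree.diam_le_diam_glue (w := w) hconn
  have hD : 1 ≤ (RadioTree.glue T w).diam :=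
    (RadioTree.one_le_diam (hconn ⟨0, hk⟩)).trans (hdiam _)
  have hntg : Nontrivial (RadioTree.GluedVertex w) :=
    SimpleGraph.nontrivial_of_diam_ne_zero (Nat.one_le_iff_ne_zero.1 hD)
  choose g z hg hgw hz hgz hpos hspan using fun i =>
    RadioTree.exists_stretched_labeling (hconn i) (hw i) (hT i).2 (hdiam i)
  have hupper := RadioTree.radioNumber_glue_le hconn hD hg hgw hz hgz hpos
  have hlower := RadioTree.lb_le_radioNumber hglue hcenter
  have hsum : ((∑ i, (g i (z i) - 1) + 1 : ℕ) : ℤ) =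
      (∑ i, ((RadioTree.radioNumber (T i) : ℤ) + ((Fintype.card (V i) : ℤ) - 1) *
        (((RadioTree.glue T w).diam : ℤ) - ((T i).diam : ℤ)))) - (k : ℤ) + 1 := by
    push_cast [hpos]
    simp [hspan, Finset.sum_sub_distrib]
  have hlb : RadioTree.lb (RadioTree.glue T w) =
      (∑ i, ((RadioTree.radioNumber (T i) : ℤ) + ((Fintype.card (V i) : ℤ) - 1) *
        (((RadioTree.glue T w).diam : ℤ) - ((T i).diam : ℤ)))) - (k : ℤ) + 1 := by
    have hweight := RadioTree.weightFrom_glue_none (w := w) hconn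
    simp only [RadioTree.weightFrom] at hweight
    have hterm : ∀ i, (RadioTree.radioNumber (T i) : ℤ) + ((Fintype.card (V i) : ℤ) - 1) *
        (((RadioTree.glue T w).diam : ℤ) - ((T i).diam : ℤ)) =
        ((Fintype.card (V i) : ℤ) - 1) * ((RadioTree.glue T w).diam + 1)
          - 2 * ∑ u, ((T i).dist u (w i) : ℤ) + 1 := by
      intro i
      rw [(hT i).2, RadioTree.lb_eq_of_weightCenters_eq_singleton (hw i)]
      ring
    rw [Finset.sum_congr rfl fun i _ => hterm i, Finset.sum_add_distrib,
      Finset.sum_sub_distrib, ← Finset.sum_mul, ← Finset.mul_sum,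
      RadioTree.lb_eq_of_weightCenters_eq_singleton hcenter, RadioTree.card_gluedVertex,
      ← Nat.cast_sum, hweight]
    simp
  refine ⟨⟨RadioTree.isTree_glue fun i => (hT i).1, ?_⟩, ?_⟩ <;> omega
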